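/- Let $(M,g)$ be an $(n+1)$-dimensional smooth Lorentzian manifold with signature $(-,+,\dots,+)$ and Levi-Civita connection $\nabla$. A smooth function $f:M\to\mathbb R$ is called a *spacetime convex function* if its Hessian $\nabla\nabla f$ has Lorentzian signature $(-,+,\dots,+)$ at every point and there is a constant $c>0$ such that $\nabla\nabla f\ge c\,g$, i.e. $(\nabla\nabla f)(V,V)\ge c\,g(V,V)$ for every $p \in M$ and every tangent vector $V\in T_pM$. If $(M,g)$ admits a spacetime convex function, then $(M,g)$ admits no closed spacelike geodesic; that is, there is no smooth affinely parametrized geodesic $\gamma:\mathbb R\to M$, $\nabla_{\dot\gamma}\dot\gamma=0$, which is periodic ($\gamma(t+T)=\gamma(t)$ for all $t$, for some $T>0$) and satisfies $g(\dot\gamma(t),\dot\gamma(t))>0$ for all $t$. -/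

import Mathlib

open Bundle Manifold
open scoped ContDiff

set_option maxSynthPendingDepth 3

noncomputable section

namespace Spacetime

/-- A bilinear form on a real vector space has Lorentzian signature `(-,+,…,+)` if it has a
pseudo-orthonormal basis `e₀, …, eₙ`: `B(e₀,e₀) = -1`, `B(eᵢ,eᵢ) = 1` for `i ≠ 0`, and
`B(eᵢ,eⱼ) = 0` for `i ≠ j`. In particular `B` is then symmetric and non-degenerate, and the space
has dimension `n + 1`. -/
def HasLorentzianSignature (n : ℕ) {V : Type*} [AddCommGroup V] [Module ℝ V]
    [TopologicalSpace V] [IsTopologicalAddGroup V] [ContinuousConstSMul ℝ V]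
    (B : V →L[ℝ] V →L[ℝ] ℝ) : Prop :=
  ∃ e : Module.Basis (Fin (n + 1)) ℝ V,
    ∀ i j, B (e i) (e j) = if i = j then (if i = 0 then -1 else 1) else 0

/-- The pullback `(u, v) ↦ B(A u, A v)` of a bilinear form `B` under a linear map `A`. -/
def pullbackForm {V W : Type*} [AddCommGroup V] [Module ℝ V] [TopologicalSpace V]
    [IsTopologicalAddGroup V] [ContinuousConstSMul ℝ V] [AddCommGroup W] [Module ℝ W]
    [TopologicalSpace W] [IsTopologicalAddGroup W] [ContinuousConstSMul ℝ W]
    (B : W →L[ℝ] W →L[ℝ] ℝ) (A : V →L[ℝ] W) : V →L[ℝ] V →L[ℝ] ℝ :=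
  (ContinuousLinearMap.precomp ℝ A) ∘L (B ∘L A)

theorem pullbackForm_apply {V W : Type*} [AddCommGroup V] [Module ℝ V] [TopologicalSpace V]
    [IsTopologicalAddGroup V] [ContinuousConstSMul ℝ V] [AddCommGroup W] [Module ℝ W]
    [TopologicalSpace W] [IsTopologicalAddGroup W] [ContinuousConstSMul ℝ W]
    (B : W →L[ℝ] W →L[ℝ] ℝ) (A : V →L[ℝ] W) (u v : V) :
    pullbackForm B A u v = B (A u) (A v) :=
  rfl

/-- For `D = ∂g`, i.e. `D(u, v, w) = (∂_u g)(v, w)`, the trilinear form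
`(u, v, w) ↦ (D(u, v, w) + D(v, u, w) - D(w, u, v)) / 2`. -/
def koszulForm {E : Type*} [NormedAddCommGroup E] [NormedSpace ℝ E]
    (D : E →L[ℝ] E →L[ℝ] E →L[ℝ] ℝ) : E →L[ℝ] E →L[ℝ] E →L[ℝ] ℝ :=
  let D' : E →L[ℝ] E →L[ℝ] E →L[ℝ] ℝ := D.flip
  let R : (E →L[ℝ] E →L[ℝ] ℝ) →L[ℝ] (E →L[ℝ] E →L[ℝ] ℝ) :=
    (ContinuousLinearMap.flipₗᵢ ℝ E E ℝ).toContinuousLinearEquiv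
  let D'' : E →L[ℝ] E →L[ℝ] E →L[ℝ] ℝ := R ∘L D'
  (1 / 2 : ℝ) • (D + D' - D'')

theorem koszulForm_apply {E : Type*} [NormedAddCommGroup E] [NormedSpace ℝ E]
    (D : E →L[ℝ] E →L[ℝ] E →L[ℝ] ℝ) (u v w : E) :
    koszulForm D u v w = (1 / 2) * (D u v w + D v u w - D w u v) := by
  simp [koszulForm]

/-- The model space `ℝⁿ⁺¹` of an `(n+1)`-dimensional spacetime. -/
abbrev Model (n : ℕ) : Type := EuclideanSpace ℝ (Fin (n + 1))

/-- A smooth Lorentzian metric on an `(n+1)`-dimensional smooth manifold: a smooth section of the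
bundle of bilinear forms on the tangent spaces, of Lorentzian signature at each point. -/
structure LorentzianMetric (n : ℕ) (M : Type*) [TopologicalSpace M] [ChartedSpace (Model n) M]
    [IsManifold (𝓡 (n + 1)) ∞ M] where
  /-- The bilinear form on the tangent space at `p`. -/
  form (p : M) : TangentSpace (𝓡 (n + 1)) p →L[ℝ] TangentSpace (𝓡 (n + 1)) p →L[ℝ] ℝ
  signature (p : M) : HasLorentzianSignature n (form p)
  contMDiff : ContMDiff (𝓡 (n + 1))
    ((𝓡 (n + 1)).prod 𝓘(ℝ, Model n →L[ℝ] Model n →L[ℝ] ℝ)) ∞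
    (fun p ↦ TotalSpace.mk' (Model n →L[ℝ] Model n →L[ℝ] ℝ) p (form p))

variable {n : ℕ} {M : Type*} [TopologicalSpace M] [ChartedSpace (Model n) M]
  [IsManifold (𝓡 (n + 1)) ∞ M]

/-- The components `g_{μν}` of the metric in the chart `φ` around `x₀`, as a bilinear form on
`ℝⁿ⁺¹` depending on the coordinate point `y`: the pullback of `g` by `φ⁻¹` at `y`. -/
def LorentzianMetric.inChart (g : LorentzianMetric n M) (x₀ : M) (y : Model n) :
    Model n →L[ℝ] Model n →L[ℝ] ℝ :=
  let A : Model n →L[ℝ] TangentSpace (𝓡 (n + 1)) ((extChartAt (𝓡 (n + 1)) x₀).symm y) :=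
    mfderiv 𝓘(ℝ, Model n) (𝓡 (n + 1)) (extChartAt (𝓡 (n + 1)) x₀).symm y
  pullbackForm (g.form ((extChartAt (𝓡 (n + 1)) x₀).symm y)) A

theorem LorentzianMetric.inChart_apply (g : LorentzianMetric n M) (x₀ : M) (y u v : Model n) :
    g.inChart x₀ y u v =
      g.form ((extChartAt (𝓡 (n + 1)) x₀).symm y)
        (mfderiv 𝓘(ℝ, Model n) (𝓡 (n + 1)) (extChartAt (𝓡 (n + 1)) x₀).symm y u)
        (mfderiv 𝓘(ℝ, Model n) (𝓡 (n + 1)) (extChartAt (𝓡 (n + 1)) x₀).symm y v) :=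
  rfl

/-- The Christoffel symbols of the first kind,
`Γ_{λ,μν} = (∂_μ g_{νλ} + ∂_ν g_{μλ} - ∂_λ g_{μν}) / 2`, in the chart around `x₀`, as a trilinear
form `(u, v, w) ↦ Γ_{λ,μν} u^μ v^ν w^λ`. -/
def LorentzianMetric.christoffelFirst (g : LorentzianMetric n M) (x₀ : M) (y : Model n) :
    Model n →L[ℝ] Model n →L[ℝ] Model n →L[ℝ] ℝ :=
  koszulForm (fderiv ℝ (g.inChart x₀) y)

theorem LorentzianMetric.christoffelFirst_apply (g : LorentzianMetric n M) (x₀ : M)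
    (y u v w : Model n) :
    g.christoffelFirst x₀ y u v w =
      (1 / 2) * (fderiv ℝ (g.inChart x₀) y u v w + fderiv ℝ (g.inChart x₀) y v u w
        - fderiv ℝ (g.inChart x₀) y w u v) :=
  koszulForm_apply _ u v w

/-- The Christoffel symbols (of the second kind) `Γ^λ_{μν}` of the Levi-Civita connection of `g` in
the chart around `x₀`, as the bilinear map `(u, v) ↦ Γ^λ_{μν} u^μ v^ν`: the last index of the
symbols of the first kind is raised by the inverse of `w ↦ g(w, ·)`. -/
def LorentzianMetric.christoffel (g : LorentzianMetric n M) (x₀ : M) (y : Model n) :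
    Model n →L[ℝ] Model n →L[ℝ] Model n :=
  (ContinuousLinearMap.compL ℝ (Model n) (Model n →L[ℝ] ℝ) (Model n)
    (g.inChart x₀ y).inverse) ∘L g.christoffelFirst x₀ y

theorem LorentzianMetric.christoffel_apply (g : LorentzianMetric n M) (x₀ : M)
    (y u v : Model n) :
    g.christoffel x₀ y u v = (g.inChart x₀ y).inverse (g.christoffelFirst x₀ y u v) :=
  rfl

/-- The components `∂_μ ∂_ν f - Γ^λ_{μν} ∂_λ f` of the Hessian `∇_μ ∇_ν f` in the chart around
`x₀`, at the coordinate point `y`. -/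
def LorentzianMetric.hessianInChart (g : LorentzianMetric n M) (f : M → ℝ) (x₀ : M)
    (y : Model n) : Model n →L[ℝ] Model n →L[ℝ] ℝ :=
  let F : Model n → ℝ := f ∘ (extChartAt (𝓡 (n + 1)) x₀).symm
  fderiv ℝ (fderiv ℝ F) y -
    (ContinuousLinearMap.compL ℝ (Model n) (Model n) ℝ (fderiv ℝ F y)) ∘L g.christoffel x₀ y

theorem LorentzianMetric.hessianInChart_apply (g : LorentzianMetric n M) (f : M → ℝ) (x₀ : M)
    (y u v : Model n) :
    g.hessianInChart f x₀ y u v =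
      fderiv ℝ (fderiv ℝ (f ∘ (extChartAt (𝓡 (n + 1)) x₀).symm)) y u v
        - fderiv ℝ (f ∘ (extChartAt (𝓡 (n + 1)) x₀).symm) y (g.christoffel x₀ y u v) :=
  rfl

/-- The Hessian `∇∇f` of `f` with respect to the Levi-Civita connection of `g`, as a bilinear form
on the tangent space at `p`. As the Hessian is a tensor, it can be computed in any chart around
`p`; the chart used is the preferred one. -/
def LorentzianMetric.hessian (g : LorentzianMetric n M) (f : M → ℝ) (p : M) :
    TangentSpace (𝓡 (n + 1)) p →L[ℝ] TangentSpace (𝓡 (n + 1)) p →L[ℝ] ℝ :=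
  let A : TangentSpace (𝓡 (n + 1)) p →L[ℝ] Model n :=
    mfderiv (𝓡 (n + 1)) 𝓘(ℝ, Model n) (extChartAt (𝓡 (n + 1)) p) p
  pullbackForm (g.hessianInChart f p (extChartAt (𝓡 (n + 1)) p p)) A

theorem LorentzianMetric.hessian_apply (g : LorentzianMetric n M) (f : M → ℝ) (p : M)
    (U V : TangentSpace (𝓡 (n + 1)) p) :
    g.hessian f p U V =
      g.hessianInChart f p (extChartAt (𝓡 (n + 1)) p p)
        (mfderiv (𝓡 (n + 1)) 𝓘(ℝ, Model n) (extChartAt (𝓡 (n + 1)) p) p U)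
        (mfderiv (𝓡 (n + 1)) 𝓘(ℝ, Model n) (extChartAt (𝓡 (n + 1)) p) p V) :=
  rfl

/-- `f` is a spacetime convex function: it is smooth, its Hessian has Lorentzian signature
everywhere, and `∇∇f ≥ c g` for some constant `c > 0`. -/
structure IsSpacetimeConvex (g : LorentzianMetric n M) (f : M → ℝ) : Prop where
  contMDiff : ContMDiff (𝓡 (n + 1)) 𝓘(ℝ, ℝ) ∞ f
  signature (p : M) : HasLorentzianSignature n (g.hessian f p)
  exists_le : ∃ c : ℝ, 0 < c ∧ ∀ (p : M) (V : TangentSpace (𝓡 (n + 1)) p),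
    c * g.form p V V ≤ g.hessian f p V V

/-- The velocity of a curve, a tangent vector at `γ t`. -/
def velocity (γ : ℝ → M) (t : ℝ) : TangentSpace (𝓡 (n + 1)) (γ t) :=
  mfderiv 𝓘(ℝ, ℝ) (𝓡 (n + 1)) γ t (1 : ℝ)

/-- `γ : ℝ → M` is an (affinely parametrized) geodesic of `g`: it is smooth and, at every time `t`,
its expression `u` in the chart around `γ t` satisfies the geodesic equation
`u'' + Γ(u)(u', u') = 0` (which does not depend on the chart). -/
structure IsGeodesic (g : LorentzianMetric n M) (γ : ℝ → M) : Prop where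
  contMDiff : ContMDiff 𝓘(ℝ, ℝ) (𝓡 (n + 1)) ∞ γ
  geodesic_eq (t : ℝ) :
    let u : ℝ → Model n := extChartAt (𝓡 (n + 1)) (γ t) ∘ γ
    deriv (deriv u) t + g.christoffel (γ t) (u t) (deriv u t) (deriv u t) = 0

/-- `γ` is a closed spacelike geodesic: a geodesic which is periodic with some period `T > 0`, with
spacelike velocity, `g(γ', γ') > 0`. -/
structure IsClosedSpacelikeGeodesic (g : LorentzianMetric n M) (γ : ℝ → M) : Prop where
  isGeodesic : IsGeodesic g γ
  closed : ∃ T : ℝ, 0 < T ∧ Function.Periodic γ T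
  spacelike (t : ℝ) : 0 < g.form (γ t) (velocity (n := n) γ t) (velocity (n := n) γ t)

end Spacetime

end

namespace Spacetime

/-! Along a geodesic `γ` the chain rule in coordinates gives `(f ∘ γ)'' = ∇∇f(γ', γ')`: the
acceleration contributes `df(u'') = -df(Γ(u', u'))`, which is exactly the Christoffel term of the
Hessian (`IsGeodesic.hasDerivAt_deriv_comp`). If `γ` is spacelike, convexity bounds this below by `c
g(γ', γ') > 0`, so `f ∘ γ` has a strictly increasing derivative. If `γ` is closed, `f ∘ γ` and its
derivative are periodic, a contradiction (`not_periodic_of_hasDerivAt_deriv_pos`). -/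

/-- The chain rule for the second derivative of a function along a curve. -/
theorem hasDerivAt_deriv_comp {E : Type*} [NormedAddCommGroup E] [NormedSpace ℝ E]
    {F : E → ℝ} {u : ℝ → E} {t : ℝ} (hF : ContDiffAt ℝ 2 F (u t)) (hu : ContDiffAt ℝ 2 u t) :
    HasDerivAt (deriv (F ∘ u))
      (fderiv ℝ (fderiv ℝ F) (u t) (deriv u t) (deriv u t)
        + fderiv ℝ F (u t) (deriv (deriv u) t)) t := by
  -- The first-order chain rule is to be differentiated again, so it is needed near `t`; being `C²`
  -- at a point is an open condition.
  have hu1 : ∀ᶠ s in nhds t, ContDiffAt ℝ 2 u s := hu.eventually (by simp)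
  have hF1 : ∀ᶠ s in nhds t, ContDiffAt ℝ 2 F (u s) :=
    hu.continuousAt.eventually (hF.eventually (by simp))
  have heq : deriv (F ∘ u) =ᶠ[nhds t] fun s ↦ fderiv ℝ F (u s) (deriv u s) := by
    filter_upwards [hu1, hF1] with s h1 h2
    exact ((h2.differentiableAt (by simp)).hasFDerivAt.comp_hasDerivAt s
      (h1.differentiableAt (by simp)).hasDerivAt).deriv
  have hdF : HasFDerivAt (fderiv ℝ F) (fderiv ℝ (fderiv ℝ F) (u t)) (u t) :=
    ((hF.fderiv_right (m := 1) (by norm_num)).differentiableAt (by simp)).hasFDerivAt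
  have hdu : HasDerivAt (deriv u) (deriv (deriv u) t) t := by
    have h : ContDiffAt ℝ 1 (deriv u) t :=
      (hu.fderiv_right (m := 1) (by norm_num)).clm_apply contDiffAt_const
    exact (h.differentiableAt (by simp)).hasDerivAt
  have hdu' : HasDerivAt u (deriv u t) t := (hu.differentiableAt (by simp)).hasDerivAt
  exact ((hdF.comp_hasDerivAt t hdu').clm_apply hdu).congr_of_eventuallyEq heq

/-- A function with positive second derivative everywhere is not periodic. -/
theorem not_periodic_of_hasDerivAt_deriv_pos {h h₂ : ℝ → ℝ} {T : ℝ} (hT : 0 < T)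
    (hd : ∀ t, HasDerivAt (deriv h) (h₂ t) t) (hpos : ∀ t, 0 < h₂ t) :
    ¬ Function.Periodic h T := by
  intro hp
  have hmono : StrictMono (deriv h) :=
    strictMono_of_deriv_pos fun t ↦ (hd t).deriv ▸ hpos t
  -- The derivative of a periodic function takes equal values one period apart.
  have hper : deriv h (0 + T) = deriv h 0 := by
    rw [← deriv_comp_add_const]
    exact congrArg (fun k ↦ deriv k 0) (funext hp)
  exact (hmono (by linarith : (0 : ℝ) < 0 + T)).ne' hper

variable {n : ℕ} {M : Type*} [TopologicalSpace M] [ChartedSpace (Model n) M]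

/-- A smooth curve read in the chart around one of its points is smooth at that time. -/
theorem contDiffAt_extChartAt_comp {γ : ℝ → M} (hγ : ContMDiff 𝓘(ℝ, ℝ) (𝓡 (n + 1)) ∞ γ) (t : ℝ) :
    ContDiffAt ℝ ∞ (extChartAt (𝓡 (n + 1)) (γ t) ∘ γ) t := by
  rw [← contMDiffAt_iff_contDiffAt]
  exact contMDiffAt_extChartAt.comp t hγ.contMDiffAt

/-- The coordinate expression of the velocity is the derivative of the coordinate expression of
the curve. -/
theorem mfderiv_extChartAt_velocity {γ : ℝ → M} (hγ : ContMDiff 𝓘(ℝ, ℝ) (𝓡 (n + 1)) ∞ γ)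
    (t : ℝ) :
    mfderiv (𝓡 (n + 1)) 𝓘(ℝ, Model n) (extChartAt (𝓡 (n + 1)) (γ t)) (γ t)
        (velocity (n := n) γ t) = deriv (extChartAt (𝓡 (n + 1)) (γ t) ∘ γ) t := by
  have h1 : MDifferentiableAt (𝓡 (n + 1)) 𝓘(ℝ, Model n) (extChartAt (𝓡 (n + 1)) (γ t)) (γ t) :=
    (contMDiffAt_extChartAt (n := ∞)).mdifferentiableAt (by simp)
  have h2 : MDifferentiableAt 𝓘(ℝ, ℝ) (𝓡 (n + 1)) γ t :=
    hγ.contMDiffAt.mdifferentiableAt (by simp)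
  have h3 := mfderiv_comp t h1 h2
  rw [mfderiv_eq_fderiv] at h3
  exact (DFunLike.congr_fun h3 (1 : ℝ)).symm

variable [IsManifold (𝓡 (n + 1)) ∞ M]

/-- A smooth function read in a chart is smooth at the image of the centre of the chart. -/
theorem contDiffAt_comp_extChartAt_symm {f : M → ℝ} (hf : ContMDiff (𝓡 (n + 1)) 𝓘(ℝ, ℝ) ∞ f)
    (p : M) : ContDiffAt ℝ ∞ (f ∘ (extChartAt (𝓡 (n + 1)) p).symm)
      (extChartAt (𝓡 (n + 1)) p p) := by
  rw [← contMDiffAt_iff_contDiffAt]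
  exact hf.contMDiffAt.comp _ ((contMDiffOn_extChartAt_symm p).contMDiffAt
    (extChartAt_target_mem_nhds p))

/-- Along a geodesic, the second derivative of a function is its Hessian evaluated on the
velocity. -/
theorem IsGeodesic.hasDerivAt_deriv_comp {g : LorentzianMetric n M} {γ : ℝ → M}
    (hγ : IsGeodesic g γ) {f : M → ℝ} (hf : ContMDiff (𝓡 (n + 1)) 𝓘(ℝ, ℝ) ∞ f) (t : ℝ) :
    HasDerivAt (deriv (f ∘ γ))
      (g.hessian f (γ t) (velocity (n := n) γ t) (velocity (n := n) γ t)) t := by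
  set u : ℝ → Model n := extChartAt (𝓡 (n + 1)) (γ t) ∘ γ with hu
  -- The curve may leave the chart, so the coordinate expression is valid only near `t`. The Hessian
  -- at `γ t` and the geodesic equation at `t` use this same chart, so no change of coordinates
  -- arises.
  have heq : f ∘ γ =ᶠ[nhds t] (f ∘ (extChartAt (𝓡 (n + 1)) (γ t)).symm) ∘ u := by
    filter_upwards [hγ.contMDiff.continuous.continuousAt.eventually
      (extChartAt_source_mem_nhds (I := 𝓡 (n + 1)) (γ t))] with s hs
    exact congrArg f ((extChartAt (𝓡 (n + 1)) (γ t)).left_inv hs).symm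
  have hderiv := Spacetime.hasDerivAt_deriv_comp
    (F := f ∘ (extChartAt (𝓡 (n + 1)) (γ t)).symm) (u := u) (t := t)
    ((contDiffAt_comp_extChartAt_symm hf (γ t)).of_le (WithTop.coe_le_coe.2 le_top))
    ((contDiffAt_extChartAt_comp hγ.contMDiff t).of_le (WithTop.coe_le_coe.2 le_top))
  have hgeo : deriv (deriv u) t = -g.christoffel (γ t) (u t) (deriv u t) (deriv u t) :=
    eq_neg_of_add_eq_zero_left (hγ.geodesic_eq t)
  rw [hgeo, map_neg, ← sub_eq_add_neg] at hderiv
  rw [LorentzianMetric.hessian_apply, mfderiv_extChartAt_velocity hγ.contMDiff t,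
    LorentzianMetric.hessianInChart_apply]
  exact hderiv.congr_of_eventuallyEq heq.deriv

end Spacetime

theorem mainTheorem5 {n : ℕ} {M : Type*} [TopologicalSpace M]
    [ChartedSpace (EuclideanSpace ℝ (Fin (n + 1))) M] [IsManifold (𝓡 (n + 1)) ∞ M]
    (g : Spacetime.LorentzianMetric n M)
    (hf : ∃ f : M → ℝ, Spacetime.IsSpacetimeConvex g f) :
    ¬ ∃ γ : ℝ → M, Spacetime.IsClosedSpacelikeGeodesic g γ := by
  rintro ⟨γ, hγ⟩
  obtain ⟨f, hf⟩ := hf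
  obtain ⟨c, hc, hle⟩ := hf.exists_le
  obtain ⟨T, hT, hper⟩ := hγ.closed
  exact Spacetime.not_periodic_of_hasDerivAt_deriv_pos hT
    (hγ.isGeodesic.hasDerivAt_deriv_comp hf.contMDiff)
    -- `0 < c g(γ', γ') ≤ ∇∇f(γ', γ')`.
    (fun t ↦ (mul_pos hc (hγ.spacelike t)).trans_le (hle _ _)) (hper.comp f)
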